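/- Let $k \ge 2$ and consider the alphabet of $k$ pairs of brackets $(_\kappa, )_\kappa$, $\kappa \in [k]$. Let $k$-Shuffle Dyck be the language of all strings $w$ over this alphabet such that, for each $\kappa \in [k]$, deleting from $w$ all brackets whose type is not $\kappa$ leaves a 1-Dyck word, i.e. a well-balanced string over the single pair $(_\kappa, )_\kappa$. Then: 1. $k$-Shuffle Dyck is strictly context-sensitive: it is generated by a context-sensitive grammar (rules $\alpha A\beta \to \alpha\gamma\beta$ with $A$ a nonterminal and $\gamma \neq \varepsilon$, where in addition the rule $S \to \varepsilon$ for the start symbol $S$ is allowed if $S$ occurs on no right-hand side), but it is not context-free. 2. $k$-Shuffle Dyck is defined by the formula $$\bigwedge_{\kappa \in [k]} \Bigl( \bigl(\#[Q_{(_\kappa}] = \#[Q_{)_\kappa}]\bigr) \land \bigl(\#\bigl[\,\#[Q_{)_\kappa}] > \#[Q_{(_\kappa}]\,\bigr] = 0\bigr) \Bigr)$$ of the temporal counting logic $\mathsf{K_t}[\#]$. Here $Q_a$ holds at a position if the symbol there is $a$; $\#[\varphi]$ is the number of positions up to and including the current one at which $\varphi$ holds; and a formula defines the set of strings at whose last position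 it holds (the empty string is evaluated at position $0$, where each $Q_a$ is false and each $\#[\varphi]$ is $0$). 3. $k$-Shuffle Dyck is definable in C-RASP: it is recognized by a C-RASP program, that is, a finite sequence of operations, each referring only to earlier ones, of the Boolean-valued forms $P(i) := Q_a(i)$, $1$, $\neg P_1(i)$, $P_1(i) \land P_2(i)$, $C_1(i) \le C_2(i)$ and the count-valued forms $C(i) := \#[j \le i]\, P(j)$, $P(i)\,?\,C_1(i) : C_2(i)$, $C_1(i) \pm C_2(i)$, $\min(C_1(i), C_2(i))$, $\max(C_1(i), C_2(i))$, $1$. The last operation is Boolean-valued and the program accepts a string if the value of this operation at its last position is true (the empty string is again evaluated at position $0$). -/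

import Mathlib

/-! ### The language -/

/-- `1`-Dyck, the language of well-balanced strings over one pair of brackets
(`DyckStep.U` is the opening bracket, `DyckStep.D` the closing one). -/
def oneDyck : Language DyckStep := Set.range DyckWord.toList

/-- The alphabet of `k` pairs of brackets: `(κ, DyckStep.U)` and `(κ, DyckStep.D)` are the opening
and the closing bracket of type `κ`. -/
abbrev BracketSymbol (k : ℕ) : Type := Fin k × DyckStep

/-- The projection of a string of brackets onto the brackets of type `κ`: all other brackets are
erased. -/
def bracketProj {k : ℕ} (κ : Fin k) (w : List (BracketSymbol k)) : List DyckStep :=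
  (w.filter (fun x => x.1 = κ)).map Prod.snd

/-- `k`-Shuffle Dyck: the strings whose projection onto each bracket type is a `1`-Dyck word. -/
def shuffleDyck (k : ℕ) : Language (BracketSymbol k) :=
  {w | ∀ κ : Fin k, bracketProj κ w ∈ oneDyck}

/-! ### Context-sensitive grammars -/

/-- The rule `left input right → left output right`: the nonterminal `input` is rewritten to
`output` when it stands between the strings `left` and `right`. -/
structure ContextSensitiveRule (T N : Type*) where
  left : List (Symbol T N)
  input : N
  right : List (Symbol T N)
  output : List (Symbol T N)

/-- One application of the rule `r` turns `u` into `v`. -/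
def ContextSensitiveRule.Rewrites {T N : Type*} (r : ContextSensitiveRule T N)
    (u v : List (Symbol T N)) : Prop :=
  ∃ p q : List (Symbol T N),
    u = p ++ r.left ++ [Symbol.nonterminal r.input] ++ r.right ++ q ∧
    v = p ++ r.left ++ r.output ++ r.right ++ q

/-- Context-sensitive grammars over the terminals `T`. No rule erases its nonterminal, with the
usual exception: the rule `initial → ε` is allowed if `initial` occurs on the right-hand side of
no rule. -/
structure ContextSensitiveGrammar (T : Type*) where
  NT : Type
  initial : NT
  rules : Finset (ContextSensitiveRule T NT)
  erasing : ∀ r ∈ rules, r.output = [] →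
    r.left = [] ∧ r.right = [] ∧ r.input = initial ∧
      ∀ r' ∈ rules, Symbol.nonterminal initial ∉ r'.left ++ r'.output ++ r'.right

namespace ContextSensitiveGrammar

/-- One derivation step. -/
def Produces {T : Type*} (g : ContextSensitiveGrammar T) (u v : List (Symbol T g.NT)) : Prop :=
  ∃ r ∈ g.rules, r.Rewrites u v

/-- The language generated by `g`. -/
def language {T : Type*} (g : ContextSensitiveGrammar T) : Language T :=
  {w | Relation.ReflTransGen g.Produces [Symbol.nonterminal g.initial] (w.map Symbol.terminal)}

end ContextSensitiveGrammar

/-- A language is context-sensitive if some context-sensitive grammar generates it. -/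
def IsContextSensitive {T : Type*} (L : Language T) : Prop :=
  ∃ g : ContextSensitiveGrammar T, g.language = L

/-! ### Positions in a string -/

/-- The predicate `Q_a(i)`: the symbol of `w` at position `i` is `a`. Positions are `1, …, |w|`. -/
def symbolAt {α : Type*} (w : List α) (a : α) (i : ℕ) : Prop :=
  0 < i ∧ w[i - 1]? = some a

open scoped Classical in
/-- The number of positions `j` with `1 ≤ j ≤ i` such that `P j`. -/
noncomputable def countUpTo (P : ℕ → Prop) (i : ℕ) : ℕ :=
  ((Finset.Icc 1 i).filter P).card

/-! ### The temporal counting logic `K_t[#]` -/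

namespace KtSharp

/-- The two syntactic categories of `K_t[#]`. -/
inductive Category where
  | formula
  | count

/-- The expressions of `K_t[#]` over the alphabet `α`: formulas `Q_a`, `¬ φ`, `φ ∧ ψ`, `s ≤ t`,
and counting terms `# [φ]`, `s + t`, `s - t`, `1`, where `# [φ]` is the number of positions up to
the current one (inclusive) at which `φ` holds. -/
inductive Expression (α : Type*) : Category → Type _ where
  | symb (a : α) : Expression α .formula
  | neg (φ : Expression α .formula) : Expression α .formula
  | conj (φ ψ : Expression α .formula) : Expression α .formula
  | le (s t : Expression α .count) : Expression α .formula
  | since (φ : Expression α .formula) : Expression α .count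
  | add (s t : Expression α .count) : Expression α .count
  | sub (s t : Expression α .count) : Expression α .count
  | one : Expression α .count

/-- Formulas of `K_t[#]`. -/
abbrev Formula (α : Type*) := Expression α .formula

/-- Counting terms of `K_t[#]`. -/
abbrev Count (α : Type*) := Expression α .count

/-- The values of expressions: truth values for formulas, integers for counting terms. -/
abbrev Category.Value : Category → Type
  | .formula => Prop
  | .count => ℤ

/-- The value of an expression in `w` at position `i`. -/
noncomputable def Expression.eval {α : Type*} (w : List α) :
    {c : Category} → Expression α c → ℕ → c.Value
  | _, .symb a, i => symbolAt w a i
  | _, .neg φ, i => ¬ φ.eval w i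
  | _, .conj φ ψ, i => φ.eval w i ∧ ψ.eval w i
  | _, .le s t, i => (s.eval w i : ℤ) ≤ (t.eval w i : ℤ)
  | _, .since φ, i => (countUpTo (fun j => φ.eval w j) i : ℤ)
  | _, .add s t, i => (s.eval w i : ℤ) + (t.eval w i : ℤ)
  | _, .sub s t, i => (s.eval w i : ℤ) - (t.eval w i : ℤ)
  | _, .one, _ => (1 : ℤ)

/-- The language defined by `φ`: the strings at whose last position `φ` holds. The empty string
is evaluated at position `0`, where every `Q_a` is false and every `#` is `0`. -/
def Formula.language {α : Type*} (φ : Formula α) : Language α :=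
  {w | φ.eval w w.length}

/-- `s = t`. -/
def Formula.eq {α : Type*} (s t : Count α) : Formula α :=
  Expression.conj (.le s t) (.le t s)

/-- `s > t`. -/
def Formula.gt {α : Type*} (s t : Count α) : Formula α := Expression.neg (.le s t)

/-- The constant `0`. -/
def Count.zero {α : Type*} : Count α := Expression.sub .one .one

/-- Truth. -/
def Formula.top {α : Type*} : Formula α := Expression.le .one .one

/-- The conjunction of finitely many formulas. -/
def Formula.bigConj {α : Type*} {k : ℕ} (φ : Fin k → Formula α) : Formula α :=
  (List.ofFn φ).foldr Expression.conj Formula.top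

/-- The formula
`⋀_κ ((#[Q_{(κ}] = #[Q_{)κ}]) ∧ (#[#[Q_{)κ}] > #[Q_{(κ}]] = 0))`. -/
def shuffleDyckFormula (k : ℕ) : Formula (BracketSymbol k) :=
  Formula.bigConj fun κ =>
    .conj
      (Formula.eq (.since (.symb (κ, .U))) (.since (.symb (κ, .D))))
      (Formula.eq
        (.since (Formula.gt (.since (.symb (κ, .D))) (.since (.symb (κ, .U))))) Count.zero)

end KtSharp

/-! ### C-RASP -/

namespace CRASP

/-- Boolean-valued operations over the alphabet `α`, which may refer to `b` earlier Boolean-valued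
and `c` earlier count-valued operations:
`P(i) := Q_a(i)`, `P(i) := 1`, `P(i) := ¬ P₁(i)`, `P(i) := P₁(i) ∧ P₂(i)`,
`P(i) := C₁(i) ≤ C₂(i)`. -/
inductive BoolOp (α : Type*) (b c : ℕ) where
  | symb (a : α)
  | true
  | not (p : Fin b)
  | and (p q : Fin b)
  | le (s t : Fin c)

/-- Count-valued operations, which may refer to `b` earlier Boolean-valued and `c` earlier
count-valued operations:
`C(i) := # [j ≤ i] P(j)`, `C(i) := P(i) ? C₁(i) : C₂(i)`, `C(i) := C₁(i) + C₂(i)`,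
`C(i) := C₁(i) - C₂(i)`, `C(i) := min(C₁(i), C₂(i))`, `C(i) := max(C₁(i), C₂(i))`,
`C(i) := 1`. -/
inductive CountOp (b c : ℕ) where
  | count (p : Fin b)
  | cond (p : Fin b) (s t : Fin c)
  | add (s t : Fin c)
  | sub (s t : Fin c)
  | min (s t : Fin c)
  | max (s t : Fin c)
  | one

/-- C-RASP programs: finite sequences of operations, each of which refers only to earlier ones.
A term of `Program α b c` has `b` Boolean-valued and `c` count-valued operations, numbered in
order of appearance. -/
inductive Program (α : Type*) : ℕ → ℕ → Type _ where
  | nil : Program α 0 0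
  | bool {b c : ℕ} (P : Program α b c) (op : BoolOp α b c) : Program α (b + 1) c
  | count {b c : ℕ} (P : Program α b c) (op : CountOp b c) : Program α b (c + 1)

/-- The value of an operation in `w` at position `i`, given the values `B j p` and `C j s` of the
earlier operations at every position `j`. -/
def BoolOp.eval {α : Type*} {b c : ℕ} (w : List α) (B : ℕ → Fin b → Prop) (C : ℕ → Fin c → ℤ)
    (i : ℕ) : BoolOp α b c → Prop
  | .symb a => symbolAt w a i
  | .true => True
  | .not p => ¬ B i p
  | .and p q => B i p ∧ B i q
  | .le s t => C i s ≤ C i t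

open scoped Classical in
/-- The value of an operation at position `i`, given the values `B j p` and `C j s` of the earlier
operations at every position `j`. -/
noncomputable def CountOp.eval {b c : ℕ} (B : ℕ → Fin b → Prop) (C : ℕ → Fin c → ℤ)
    (i : ℕ) : CountOp b c → ℤ
  | .count p => countUpTo (fun j => B j p) i
  | .cond p s t => if B i p then C i s else C i t
  | .add s t => C i s + C i t
  | .sub s t => C i s - C i t
  | .min s t => Min.min (C i s) (C i t)
  | .max s t => Max.max (C i s) (C i t)
  | .one => 1

/-- The values of all operations of a program in `w` at every position. -/
noncomputable def Program.eval {α : Type*} (w : List α) :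
    {b c : ℕ} → Program α b c → (ℕ → Fin b → Prop) × (ℕ → Fin c → ℤ)
  | _, _, .nil => (fun _ => Fin.elim0, fun _ => Fin.elim0)
  | _, _, .bool P op =>
    (fun i => Fin.snoc (α := fun _ => Prop) ((P.eval w).1 i)
      (op.eval w (P.eval w).1 (P.eval w).2 i), (P.eval w).2)
  | _, _, .count P op =>
    ((P.eval w).1, fun i => Fin.snoc (α := fun _ => ℤ) ((P.eval w).2 i)
      (op.eval (P.eval w).1 (P.eval w).2 i))

/-- The language recognized by the program that consists of `P` followed by the Boolean-valued
operation `out`: the strings at whose last position `out` is true. The empty string is evaluated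
at position `0`, where every `Q_a` is false and every `#` is `0`. -/
def recognized {α : Type*} {b c : ℕ} (P : Program α b c) (out : BoolOp α b c) : Language α :=
  {w | out.eval w (P.eval w).1 (P.eval w).2 w.length}

/-- A language is definable in C-RASP if some C-RASP program recognizes it. -/
def Definable {α : Type*} (L : Language α) : Prop :=
  ∃ (b c : ℕ) (P : Program α b c) (out : BoolOp α b c), recognized P out = L

end CRASP

/-! Give opening and closing brackets of type κ the weights 1 and -1 and all other brackets the
weight 0. A word is in shuffle Dyck iff for every κ the running sum stays nonnegative and ends at 0
(`mem_shuffleDyck_iff_balanced`, `mem_shuffleDyck_iff_count`). The formula expresses this through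
prefix counts. Each construct of `K_t[#]` is a single C-RASP operation, so induction on expressions
(`CRASP.hasExtension`) turns the formula into a program.

Shuffle Dyck words are exactly what arises from the empty word by inserting adjacent pairs and
moving closing brackets to the right past arbitrary letters. Four context-sensitive rules realize
one such move, D b → F b → F S → b S → b D, where F is `first κ b` and S is `second κ b`. For
soundness, derivations may interleave these rules or leave them unfinished, so `read` assigns a word
to every sentential form: F reads as D, and S reads as b directly after its F and as D elsewhere.
Then only the third rule performs the exchange.

Non-context-freeness uses substitution instead of pumping. Words derived from the same nonterminal
are interchangeable in any context within the language, hence have equal imbalance. The grammar has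
finitely many rules, so the imbalance of such factors is at most some d, whatever their length
(`exists_bound`). But a factor of `crossing κ₀ κ₁ n` of length at most n contains no opening and
closing bracket of the same type, so its imbalance is at least its length (`length_le_imbalance`).
-/

/-! ### WeightBalanced strings with respect to an integer weight -/

/-- `WeightBalanced δ z w`: starting from the level `z` and adding the weights `δ a` of the letters
of `w` one after the other, the level never becomes negative and is `0` in the end. -/
def WeightBalanced {α : Type*} (δ : α → ℤ) : ℤ → List α → Prop
  | z, [] => z = 0
  | z, a :: w => 0 ≤ z + δ a ∧ WeightBalanced δ (z + δ a) w

namespace WeightBalanced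

variable {α : Type*} {δ : α → ℤ}

/-- The index `i` may be unbounded because `take` stabilizes beyond the end. The case `i = 0` is
where `hz` is needed, since the recursion never checks the starting level. -/
theorem iff_sum {z : ℤ} (hz : 0 ≤ z) (w : List α) :
    WeightBalanced δ z w ↔ z + (w.map δ).sum = 0 ∧ ∀ i, 0 ≤ z + ((w.take i).map δ).sum := by
  induction w generalizing z with
  | nil => simp [WeightBalanced, hz]
  | cons a w ih =>
    constructor
    · rintro ⟨h0, h⟩
      obtain ⟨h1, h2⟩ := (ih h0).1 h
      refine ⟨by simpa [add_assoc] using h1, fun i => ?_⟩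
      cases i with
      | zero => simpa using hz
      | succ i => simpa [add_assoc] using h2 i
    · rintro ⟨h1, h2⟩
      have h0 : 0 ≤ z + δ a := by simpa using h2 1
      refine ⟨h0, (ih h0).2 ⟨by simpa [add_assoc] using h1, fun i => ?_⟩⟩
      simpa [add_assoc] using h2 (i + 1)

theorem append_mono {q q' : List α}
    (hq : ∀ z, 0 ≤ z → WeightBalanced δ z q → WeightBalanced δ z q')
    (p : List α) {z : ℤ} (hz : 0 ≤ z) (h : WeightBalanced δ z (p ++ q)) :
    WeightBalanced δ z (p ++ q') := by
  induction p generalizing z with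
  | nil => exact hq z hz h
  | cons a p ih => exact ⟨h.1, ih h.1 h.2⟩

/-- The new intermediate level `z + δ b` is at least `z + δ a + δ b`, which was already known to be
nonnegative. -/
theorem swap {a b : α} (ha : δ a ≤ 0) {q : List α} {z : ℤ}
    (h : WeightBalanced δ z (a :: b :: q)) : WeightBalanced δ z (b :: a :: q) := by
  obtain ⟨h1, h2, h3⟩ := h
  refine ⟨by linarith, by linarith, ?_⟩
  rwa [add_right_comm] at h3

theorem insert {a b : α} (ha : 0 ≤ δ a) (hab : δ a + δ b = 0) {q : List α} {z : ℤ} (hz : 0 ≤ z)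
    (h : WeightBalanced δ z q) : WeightBalanced δ z (a :: b :: q) := by
  have e : z + δ a + δ b = z := by linarith
  exact ⟨by linarith, by linarith, by rwa [e]⟩

end WeightBalanced

/-! ### Shuffle Dyck as a set of balanced strings -/

/-- `1` for opening and `-1` for closing brackets. -/
def DyckStep.weight : DyckStep → ℤ
  | .U => 1
  | .D => -1

/-- `1` for opening and `-1` for closing brackets of type `κ`, and `0` for other brackets. -/
def bracketWeight {k : ℕ} (κ : Fin k) (a : BracketSymbol k) : ℤ :=
  if a.1 = κ then a.2.weight else 0

@[simp] theorem bracketWeight_U {k : ℕ} (κ κ' : Fin k) :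
    bracketWeight κ (κ', .U) = if κ' = κ then 1 else 0 := rfl

@[simp] theorem bracketWeight_D {k : ℕ} (κ κ' : Fin k) :
    bracketWeight κ (κ', .D) = if κ' = κ then -1 else 0 := rfl

theorem DyckStep.sum_weight (l : List DyckStep) :
    (l.map DyckStep.weight).sum = (l.count .U : ℤ) - l.count .D := by
  induction l with
  | nil => simp
  | cons a l ih =>
    cases a <;> simp [ih, DyckStep.weight] <;> ring

theorem sum_bracketWeight {k : ℕ} (κ : Fin k) (l : List (BracketSymbol k)) :
    (l.map (bracketWeight κ)).sum = (l.count (κ, .U) : ℤ) - l.count (κ, .D) := by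
  induction l with
  | nil => simp
  | cons a l ih =>
    obtain ⟨κ', _ | _⟩ := a <;> by_cases h : κ' = κ <;>
      simp [ih, h] <;> ring

theorem mem_oneDyck_iff (l : List DyckStep) : l ∈ oneDyck ↔ WeightBalanced DyckStep.weight 0 l := by
  simp only [WeightBalanced.iff_sum le_rfl, DyckStep.sum_weight]
  constructor
  · rintro ⟨p, rfl⟩
    have h1 := p.count_U_eq_count_D
    refine ⟨by omega, fun i => ?_⟩
    have h2 := p.count_D_le_count_U i
    omega
  · rintro ⟨h1, h2⟩
    exact ⟨⟨l, by omega, fun i => by have := h2 i; omega⟩, rfl⟩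

/-- Letters of other types do not move the level, but the right side still tests it there; `hz`
makes these tests vacuous. -/
theorem balanced_bracketProj {k : ℕ} (κ : Fin k) (w : List (BracketSymbol k)) {z : ℤ}
    (hz : 0 ≤ z) :
    WeightBalanced DyckStep.weight z (bracketProj κ w) ↔ WeightBalanced (bracketWeight κ) z w := by
  induction w generalizing z with
  | nil => rfl
  | cons a w ih =>
    by_cases h : a.1 = κ
    · have e : bracketProj κ (a :: w) = a.2 :: bracketProj κ w := by simp [bracketProj, h]
      rw [e]
      simp only [WeightBalanced, bracketWeight, h, if_true]
      exact and_congr_right fun h0 => ih h0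
    · have e : bracketProj κ (a :: w) = bracketProj κ w := by simp [bracketProj, h]
      rw [e, ih hz]
      simp [WeightBalanced, bracketWeight, h, hz]

theorem mem_shuffleDyck_iff_balanced {k : ℕ} (w : List (BracketSymbol k)) :
    w ∈ shuffleDyck k ↔ ∀ κ, WeightBalanced (bracketWeight κ) 0 w :=
  forall_congr' fun κ => (mem_oneDyck_iff _).trans (balanced_bracketProj κ w le_rfl)

theorem mem_shuffleDyck_iff_count {k : ℕ} (w : List (BracketSymbol k)) :
    w ∈ shuffleDyck k ↔ ∀ κ, w.count (κ, .U) = w.count (κ, .D) ∧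
      ∀ i, (w.take i).count (κ, .D) ≤ (w.take i).count (κ, .U) := by
  simp only [mem_shuffleDyck_iff_balanced, WeightBalanced.iff_sum le_rfl, sum_bracketWeight]
  refine forall_congr' fun κ => and_congr (by omega) (forall_congr' fun i => by omega)

/-! ### Counting positions -/

theorem countUpTo_symbolAt {α : Type*} [BEq α] [LawfulBEq α] (w : List α) (a : α) (i : ℕ) :
    countUpTo (symbolAt w a) i = (w.take i).count a := by
  classical
  induction i with
  | zero => simp [countUpTo]
  | succ i ih =>
    unfold countUpTo at ih ⊢
    rw [← Finset.insert_Icc_right_eq_Icc_add_one (by omega), Finset.filter_insert]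
    have hn : i + 1 ∉ (Finset.Icc 1 i).filter (symbolAt w a) := by simp
    rw [List.take_add_one, List.count_append, ← ih]
    rcases hw : w[i]? with _ | b
    · simp [symbolAt, hw]
    · by_cases hb : b = a
      · simp [symbolAt, hw, hb]
      · simp [symbolAt, hw, hb]

theorem countUpTo_eq_zero_iff (P : ℕ → Prop) (n : ℕ) :
    countUpTo P n = 0 ↔ ∀ i, 1 ≤ i → i ≤ n → ¬ P i := by
  classical
  simp [countUpTo, Finset.filter_eq_empty_iff]

/-! ### The formula of `K_t[#]` -/

namespace KtSharp

theorem Formula.eval_bigConj {α : Type*} {k : ℕ} (φ : Fin k → Formula α) (w : List α) (i : ℕ) :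
    (Formula.bigConj φ).eval w i ↔ ∀ κ, (φ κ).eval w i := by
  have key : ∀ l : List (Formula α),
      (l.foldr Expression.conj Formula.top).eval w i ↔ ∀ ψ ∈ l, ψ.eval w i := by
    intro l
    induction l with
    | nil => simp [Formula.top, Expression.eval]
    | cons ψ l ih =>
      rw [List.forall_mem_cons, ← ih]
      rfl
  rw [Formula.bigConj, key]
  simp [List.mem_ofFn]

theorem language_shuffleDyckFormula (k : ℕ) :
    Formula.language (shuffleDyckFormula k) = shuffleDyck k := by
  ext w
  rw [mem_shuffleDyck_iff_count]
  refine (Formula.eval_bigConj _ _ _).trans (forall_congr' fun κ => ?_)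
  have hs : ∀ (s : DyckStep) (j : ℕ),
      countUpTo (fun j => symbolAt w (κ, s) j) j = (w.take j).count ((κ, s) : BracketSymbol k) :=
    fun s j => countUpTo_symbolAt w (κ, s) j
  simp only [Formula.eq, Formula.gt, Count.zero, Expression.eval, hs, List.take_length]
  dsimp only [Category.Value]
  refine and_congr (by omega) ?_
  have hz : ∀ n : ℕ, ((n : ℤ) ≤ 1 - 1 ∧ (1 - 1 : ℤ) ≤ n) ↔ n = 0 := by omega
  rw [hz, countUpTo_eq_zero_iff]
  constructor
  · intro h i
    -- The formula only speaks about positions from 1 to the length. Prefix 0 is trivial, and a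
    -- larger `i` gives the whole word, which is the prefix at the last position unless the word is
    -- empty.
    rcases Nat.eq_zero_or_pos i with rfl | hi
    · simp
    · rcases le_total i w.length with hl | hl
      · have := h i hi hl
        omega
      · rcases Nat.eq_zero_or_pos w.length with h0 | h0
        · simp [List.length_eq_zero_iff.1 h0]
        · have := h _ h0 le_rfl
          rw [List.take_of_length_le hl]
          rw [List.take_length] at this
          omega
  · intro h i _ _
    have := h i
    omega

end KtSharp

/-! ### Translation of `K_t[#]` into C-RASP -/

namespace CRASP

/-- `P'` extends `P`: it computes, among others, all values that `P` computes. -/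
def Extends {α : Type*} {b c b' c' : ℕ} (P : Program α b c) (P' : Program α b' c') : Prop :=
  ∃ (f : Fin b → Fin b') (g : Fin c → Fin c'), ∀ w i,
    (∀ p, (P'.eval w).1 i (f p) = (P.eval w).1 i p) ∧
    (∀ s, (P'.eval w).2 i (g s) = (P.eval w).2 i s)

namespace Extends

variable {α : Type*} {b c b' c' b'' c'' : ℕ}

theorem refl (P : Program α b c) : Extends P P := ⟨id, id, fun _ _ => ⟨fun _ => rfl, fun _ => rfl⟩⟩

theorem trans {P : Program α b c} {P' : Program α b' c'} {P'' : Program α b'' c''}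
    (h : Extends P P') (h' : Extends P' P'') : Extends P P'' := by
  obtain ⟨f, g, h⟩ := h
  obtain ⟨f', g', h'⟩ := h'
  exact ⟨f' ∘ f, g' ∘ g, fun w i =>
    ⟨fun p => ((h' w i).1 _).trans ((h w i).1 p), fun s => ((h' w i).2 _).trans ((h w i).2 s)⟩⟩

theorem bool (P : Program α b c) (op : BoolOp α b c) : Extends P (P.bool op) :=
  ⟨Fin.castSucc, id, fun w i => ⟨fun p => by simp [Program.eval], fun _ => rfl⟩⟩

theorem count (P : Program α b c) (op : CountOp b c) : Extends P (P.count op) :=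
  ⟨id, Fin.castSucc, fun w i => ⟨fun _ => rfl, fun s => by simp [Program.eval]⟩⟩

end Extends

/-- Some operation of the program `P` computes the value of the expression `e`. -/
def Computes {α : Type*} {b c : ℕ} (P : Program α b c) :
    {d : KtSharp.Category} → KtSharp.Expression α d → Prop
  | .formula, e => ∃ p, ∀ w i, (P.eval w).1 i p = e.eval w i
  | .count, e => ∃ s, ∀ w i, (P.eval w).2 i s = e.eval w i

theorem Computes.of_extends {α : Type*} {b c b' c' : ℕ} {P : Program α b c}
    {P' : Program α b' c'} (hP : Extends P P') {d : KtSharp.Category}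
    {e : KtSharp.Expression α d} (h : Computes P e) : Computes P' e := by
  obtain ⟨f, g, hP⟩ := hP
  cases d
  · obtain ⟨p, hp⟩ := h
    exact ⟨f p, fun w i => ((hP w i).1 p).trans (hp w i)⟩
  · obtain ⟨s, hs⟩ := h
    exact ⟨g s, fun w i => ((hP w i).2 s).trans (hs w i)⟩

/-- The program `P` has an extension that computes the expression `e`. -/
def HasExtension {α : Type*} {b c : ℕ} (P : Program α b c) {d : KtSharp.Category}
    (e : KtSharp.Expression α d) : Prop :=
  ∃ (b' c' : ℕ) (P' : Program α b' c'), Extends P P' ∧ Computes P' e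

namespace HasExtension

variable {α : Type*} {b c b' c' : ℕ} {P : Program α b c} {P' : Program α b' c'}

theorem bool {φ : KtSharp.Formula α} (hP : Extends P P') (op : BoolOp α b' c')
    (h : ∀ w i, op.eval w (P'.eval w).1 (P'.eval w).2 i = φ.eval w i) : HasExtension P φ :=
  ⟨_, _, P'.bool op, hP.trans (.bool _ _), Fin.last _, fun w i => by simp [Program.eval, h]⟩

theorem count {t : KtSharp.Count α} (hP : Extends P P') (op : CountOp b' c')
    (h : ∀ w i, op.eval (P'.eval w).1 (P'.eval w).2 i = t.eval w i) : HasExtension P t :=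
  ⟨_, _, P'.count op, hP.trans (.count _ _), Fin.last _, fun w i => by simp [Program.eval, h]⟩

/-- The second extension is built on top of the first, so a single program computes both values;
this is why the hypotheses quantify over all starting programs. -/
theorem pair {d₁ d₂ : KtSharp.Category} {e₁ : KtSharp.Expression α d₁}
    {e₂ : KtSharp.Expression α d₂}
    (h₁ : ∀ {b c : ℕ} (P : Program α b c), HasExtension P e₁)
    (h₂ : ∀ {b c : ℕ} (P : Program α b c), HasExtension P e₂) (P : Program α b c) :
    ∃ (b' c' : ℕ) (P' : Program α b' c'), Extends P P' ∧ Computes P' e₁ ∧ Computes P' e₂ := by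
  obtain ⟨_, _, P₁, hP₁, hc₁⟩ := h₁ P
  obtain ⟨_, _, P₂, hP₂, hc₂⟩ := h₂ P₁
  exact ⟨_, _, P₂, hP₁.trans hP₂, hc₁.of_extends hP₂, hc₂⟩

end HasExtension

open HasExtension in
/-- Every program can be extended to one that computes a given expression of `K_t[#]`. -/
theorem hasExtension {α : Type*} {d : KtSharp.Category} (e : KtSharp.Expression α d)
    {b c : ℕ} (P : Program α b c) : HasExtension P e := by
  induction e generalizing b c with
  | symb a => exact bool (.refl P) (.symb a) fun _ _ => rfl
  | neg φ ih =>
    obtain ⟨_, _, P', hP, p, hp⟩ := ih P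
    exact bool hP (.not p) fun w i => by simp [BoolOp.eval, KtSharp.Expression.eval, hp]
  | conj φ ψ ih₁ ih₂ =>
    obtain ⟨_, _, P', hP, ⟨p, hp⟩, q, hq⟩ := pair ih₁ ih₂ P
    exact bool hP (.and p q) fun w i => by simp [BoolOp.eval, KtSharp.Expression.eval, hp, hq]
  | le s t ih₁ ih₂ =>
    obtain ⟨_, _, P', hP, ⟨p, hp⟩, q, hq⟩ := pair ih₁ ih₂ P
    exact bool hP (.le p q) fun w i => by simp [BoolOp.eval, KtSharp.Expression.eval, hp, hq]
  | since φ ih =>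
    obtain ⟨_, _, P', hP, p, hp⟩ := ih P
    exact count hP (.count p) fun w i => by simp [CountOp.eval, KtSharp.Expression.eval, hp]
  | add s t ih₁ ih₂ =>
    obtain ⟨_, _, P', hP, ⟨p, hp⟩, q, hq⟩ := pair ih₁ ih₂ P
    exact count hP (.add p q) fun w i => by simp [CountOp.eval, KtSharp.Expression.eval, hp, hq]
  | sub s t ih₁ ih₂ =>
    obtain ⟨_, _, P', hP, ⟨p, hp⟩, q, hq⟩ := pair ih₁ ih₂ P
    exact count hP (.sub p q) fun w i => by simp [CountOp.eval, KtSharp.Expression.eval, hp, hq]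
  | one => exact count (.refl P) .one fun _ _ => rfl

/-- Languages definable in `K_t[#]` are definable in C-RASP. -/
theorem definable_language {α : Type*} (φ : KtSharp.Formula α) : Definable φ.language := by
  obtain ⟨b, c, P, -, p, hp⟩ := hasExtension φ Program.nil
  -- The output must be a new operation and there is no copy operation; `p ∧ p` serves as one.
  refine ⟨b, c, P, .and p p, ?_⟩
  ext w
  change (P.eval w).1 w.length p ∧ (P.eval w).1 w.length p ↔ φ.eval w w.length
  rw [hp, and_self]

end CRASP

/-! ### A context-sensitive grammar for shuffle Dyck -/

/-- Nonterminals of the grammar. `letter a` stands for the terminal `a`; `start` is the initial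
symbol and `gen` generates pairs of brackets. The nonterminals `first κ b` and `second κ b` are used
to exchange the letters `(κ, D)` and `b`. -/
inductive ShuffleNT (k : ℕ) where
  | start
  | gen
  | letter (a : BracketSymbol k)
  | first (κ : Fin k) (b : BracketSymbol k)
  | second (κ : Fin k) (b : BracketSymbol k)

namespace ShuffleNT

variable {k : ℕ}

/-- Sentential forms. -/
abbrev Form (k : ℕ) := List (Symbol (BracketSymbol k) (ShuffleNT k))

/-- The nonterminal `n` as a symbol. -/
abbrev sym (n : ShuffleNT k) : Symbol (BracketSymbol k) (ShuffleNT k) := Symbol.nonterminal n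

/-- The rules of the grammar. -/
inductive IsRule : ContextSensitiveRule (BracketSymbol k) (ShuffleNT k) → Prop
  | empty : IsRule ⟨[], start, [], []⟩
  | start : IsRule ⟨[], start, [], [sym gen]⟩
  | pair (κ : Fin k) :
      IsRule ⟨[], gen, [], [sym gen, sym (letter (κ, .U)), sym (letter (κ, .D))]⟩
  | last (κ : Fin k) : IsRule ⟨[], gen, [], [sym (letter (κ, .U)), sym (letter (κ, .D))]⟩
  | terminal (a : BracketSymbol k) : IsRule ⟨[], letter a, [], [Symbol.terminal a]⟩
  | swap₁ (κ : Fin k) (b : BracketSymbol k) :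
      IsRule ⟨[], letter (κ, .D), [sym (letter b)], [sym (first κ b)]⟩
  | swap₂ (κ : Fin k) (b : BracketSymbol k) :
      IsRule ⟨[sym (first κ b)], letter b, [], [sym (second κ b)]⟩
  | swap₃ (κ : Fin k) (b : BracketSymbol k) :
      IsRule ⟨[], first κ b, [sym (second κ b)], [sym (letter b)]⟩
  | swap₄ (κ : Fin k) (b : BracketSymbol k) :
      IsRule ⟨[sym (letter b)], second κ b, [], [sym (letter (κ, .D))]⟩

instance : Finite DyckStep :=
  Finite.of_injective (fun s : DyckStep => decide (s = .U)) fun s t h => by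
    cases s <;> cases t <;> simp_all

theorem finite_isRule : {r | IsRule (k := k) r}.Finite := by
  have h : {r | IsRule (k := k) r} ⊆ Set.range (fun i :
      (Unit ⊕ Unit) ⊕ (Fin k ⊕ Fin k) ⊕ BracketSymbol k ⊕ (Fin 4 × Fin k × BracketSymbol k) =>
      match i with
      | .inl (.inl _) => ⟨[], .start, [], []⟩
      | .inl (.inr _) => ⟨[], .start, [], [sym gen]⟩
      | .inr (.inl (.inl κ)) =>
        ⟨[], gen, [], [sym gen, sym (letter (κ, .U)), sym (letter (κ, .D))]⟩
      | .inr (.inl (.inr κ)) => ⟨[], gen, [], [sym (letter (κ, .U)), sym (letter (κ, .D))]⟩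
      | .inr (.inr (.inl a)) => ⟨[], letter a, [], [Symbol.terminal a]⟩
      | .inr (.inr (.inr (0, κ, b))) =>
        ⟨[], letter (κ, .D), [sym (letter b)], [sym (first κ b)]⟩
      | .inr (.inr (.inr (1, κ, b))) => ⟨[sym (first κ b)], letter b, [], [sym (second κ b)]⟩
      | .inr (.inr (.inr (2, κ, b))) => ⟨[], first κ b, [sym (second κ b)], [sym (letter b)]⟩
      | .inr (.inr (.inr (3, κ, b))) =>
        ⟨[sym (letter b)], second κ b, [], [sym (letter (κ, .D))]⟩) := by
    rintro r (_ | _ | κ | κ | a | ⟨κ, b⟩ | ⟨κ, b⟩ | ⟨κ, b⟩ | ⟨κ, b⟩)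
    · exact ⟨.inl (.inl ()), rfl⟩
    · exact ⟨.inl (.inr ()), rfl⟩
    · exact ⟨.inr (.inl (.inl κ)), rfl⟩
    · exact ⟨.inr (.inl (.inr κ)), rfl⟩
    · exact ⟨.inr (.inr (.inl a)), rfl⟩
    · exact ⟨.inr (.inr (.inr (0, κ, b))), rfl⟩
    · exact ⟨.inr (.inr (.inr (1, κ, b))), rfl⟩
    · exact ⟨.inr (.inr (.inr (2, κ, b))), rfl⟩
    · exact ⟨.inr (.inr (.inr (3, κ, b))), rfl⟩
  exact (Set.finite_range _).subset h

end ShuffleNT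

open ShuffleNT in
/-- A context-sensitive grammar that generates `k`-Shuffle Dyck. -/
noncomputable def shuffleGrammar (k : ℕ) : ContextSensitiveGrammar (BracketSymbol k) where
  NT := ShuffleNT k
  initial := .start
  rules := finite_isRule.toFinset
  erasing := by
    intro r hr h
    rw [Set.Finite.mem_toFinset] at hr
    cases hr <;> simp_all
    intro r' hr'
    cases hr' <;> simp

namespace ShuffleNT

variable {k : ℕ}

theorem produces_iff {u v : Form k} : (shuffleGrammar k).Produces u v ↔
    ∃ r : ContextSensitiveRule (BracketSymbol k) (ShuffleNT k), IsRule r ∧ r.Rewrites u v := by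
  change (∃ r ∈ finite_isRule.toFinset, r.Rewrites u v) ↔ _
  simp

/-! #### Soundness -/

/-- The string that the symbol `s` stands for, if the symbol before it is `m`. -/
noncomputable def value (m : Symbol (BracketSymbol k) (ShuffleNT k)) :
    Symbol (BracketSymbol k) (ShuffleNT k) → List (BracketSymbol k)
  | .terminal a => [a]
  | .nonterminal start => []
  | .nonterminal gen => []
  | .nonterminal (letter a) => [a]
  | .nonterminal (first κ _) => [(κ, .D)]
  | .nonterminal (second κ b) =>
    open scoped Classical in if m = sym (first κ b) then [b] else [(κ, .D)]

/-- The string that a sentential form stands for, if the symbol before it is `m`. -/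
noncomputable def read : Symbol (BracketSymbol k) (ShuffleNT k) → Form k → List (BracketSymbol k)
  | _, [] => []
  | m, s :: u => value m s ++ read s u

theorem read_terminal (m : Symbol (BracketSymbol k) (ShuffleNT k)) (w : List (BracketSymbol k)) :
    read m (w.map Symbol.terminal) = w := by
  induction w generalizing m with
  | nil => rfl
  | cons a w ih => simp [read, value, ih]

/-- The preceding symbol matters only to a `second κ b`, and only if it is a `first κ b`. -/
theorem read_congr {m m' : Symbol (BracketSymbol k) (ShuffleNT k)}
    (hm : ∀ κ b, m ≠ sym (first κ b)) (hm' : ∀ κ b, m' ≠ sym (first κ b)) (u : Form k) :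
    read m u = read m' u := by
  cases u with
  | nil => rfl
  | cons s u =>
    have : value m s = value m' s := by
      rcases s with a | (_ | _ | a | ⟨κ, b⟩ | ⟨κ, b⟩) <;> simp [value, hm, hm']
    simp [read, this]

/-- `read` scans with a memory of one symbol, so a prefix acts on the remainder only through its
last symbol. -/
theorem exists_read_append (p : Form k) (m : Symbol (BracketSymbol k) (ShuffleNT k)) :
    ∃ x m', ∀ u, read m (p ++ u) = x ++ read m' u := by
  induction p generalizing m with
  | nil => exact ⟨[], m, fun _ => rfl⟩
  | cons s p ih =>
    obtain ⟨x, m', h⟩ := ih s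
    exact ⟨value m s ++ x, m', fun u => by simp [read, h]⟩

/-- Shuffle Dyck is closed under inserting a matching pair. -/
theorem mem_shuffleDyck_insert {x y : List (BracketSymbol k)} (κ : Fin k)
    (h : x ++ y ∈ shuffleDyck k) : x ++ (κ, .U) :: (κ, .D) :: y ∈ shuffleDyck k := by
  rw [mem_shuffleDyck_iff_balanced] at h ⊢
  refine fun κ' => WeightBalanced.append_mono (fun z hz hq => ?_) x le_rfl (h κ')
  refine WeightBalanced.insert ?_ ?_ hz hq
  · rw [bracketWeight_U]; split_ifs <;> simp
  · rw [bracketWeight_U, bracketWeight_D]; split_ifs <;> simp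

/-- Shuffle Dyck is closed under moving a closing bracket to the right. -/
theorem mem_shuffleDyck_swap {x y : List (BracketSymbol k)} {κ : Fin k} {b : BracketSymbol k}
    (h : x ++ (κ, .D) :: b :: y ∈ shuffleDyck k) :
    x ++ b :: (κ, .D) :: y ∈ shuffleDyck k := by
  rw [mem_shuffleDyck_iff_balanced] at h ⊢
  refine fun κ' => WeightBalanced.append_mono (fun z _ hq => ?_) x le_rfl (h κ')
  refine WeightBalanced.swap ?_ hq
  rw [bracketWeight_D]; split_ifs <;> simp

/-- No right-hand side contains `start`, so an occurrence in `v` would come from the untouched part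
of `u`, making `u` longer than one symbol. This confines the erasing rule to `[start]`; elsewhere,
erasing could bring a `first` next to its `second` and change the reading. -/
theorem start_of_produces {u v : Form k} (h : (shuffleGrammar k).Produces u v)
    (hu : sym start ∈ u → u = [sym start]) : sym start ∉ v := by
  obtain ⟨r, hr, p, q, rfl, rfl⟩ := produces_iff.1 h
  intro hv
  have hpq : sym start ∈ p ++ q := by
    cases hr <;> simpa using hv
  have := congrArg List.length (hu (by
    simp only [List.mem_append] at hpq ⊢
    tauto))
  have := List.length_pos_of_mem hpq
  simp only [List.length_append, List.length_singleton] at *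
  omega

/-- `pair` and `last` insert a matching pair into the reading, `swap₃` moves a closing bracket one
letter to the right, and all other rules leave the reading unchanged. -/
theorem read_mem_of_produces {u v : Form k} (h : (shuffleGrammar k).Produces u v)
    (hs : sym start ∈ u → u = [sym start])
    (hu : read (sym start) u ∈ shuffleDyck k) : read (sym start) v ∈ shuffleDyck k := by
  obtain ⟨r, hr, p, q, rfl, rfl⟩ := produces_iff.1 h
  obtain ⟨x, m, hx⟩ := exists_read_append p (sym start)
  have hq : ∀ n n' : ShuffleNT k, (∀ κ b, n ≠ first κ b) → (∀ κ b, n' ≠ first κ b) →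
      read (sym n) q = read (sym n') q := fun n n' h h' =>
    read_congr (by simpa using h) (by simpa using h') q
  simp only [List.append_assoc, hx] at hu ⊢
  cases hr with
  | empty =>
    obtain ⟨-, rfl⟩ : p = [] ∧ q = [] := by
      simpa [List.append_eq_singleton_iff] using hs (by simp)
    exact hu
  | start =>
    simp only [read, value, List.nil_append, List.cons_append] at hu ⊢
    rwa [hq gen start (by simp) (by simp)]
  | pair κ =>
    simp only [read, value, List.nil_append, List.cons_append] at hu ⊢
    rw [hq _ gen (by simp) (by simp)]
    exact mem_shuffleDyck_insert κ hu
  | last κ =>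
    simp only [read, value, List.nil_append, List.cons_append] at hu ⊢
    rw [hq _ gen (by simp) (by simp)]
    exact mem_shuffleDyck_insert κ hu
  | terminal a =>
    simp only [read, value, List.nil_append, List.cons_append] at hu ⊢
    rwa [read_congr (m' := sym (letter a)) (by simp) (by simp)]
  | swap₁ κ b =>
    simpa [read, value] using hu
  | swap₂ κ b =>
    simp only [read, value, List.nil_append, List.cons_append, if_true] at hu ⊢
    rwa [hq (second κ b) (letter b) (by simp) (by simp)]
  | swap₃ κ b =>
    simp [read, value] at hu ⊢
    exact mem_shuffleDyck_swap hu
  | swap₄ κ b =>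
    simp [read, value] at hu ⊢
    rwa [hq _ (second κ b) (by simp) (by simp)]

/-! #### Completeness -/

/-- The sentential form of letters that stands for the string `w`. -/
abbrev letters (w : List (BracketSymbol k)) : Form k := w.map fun a => sym (letter a)

/-- Derivability in the grammar. -/
abbrev Derives (u v : Form k) : Prop := Relation.ReflTransGen (shuffleGrammar k).Produces u v

theorem Derives.of_isRule {r : ContextSensitiveRule (BracketSymbol k) (ShuffleNT k)}
    (hr : IsRule r) (p q : Form k) :
    Derives (p ++ r.left ++ [sym r.input] ++ r.right ++ q)
      (p ++ r.left ++ r.output ++ r.right ++ q) :=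
  .single (produces_iff.2 ⟨r, hr, p, q, rfl, rfl⟩)

theorem Derives.terminals (w : List (BracketSymbol k)) (p : Form k) :
    Derives (p ++ letters w) (p ++ w.map Symbol.terminal) := by
  induction w generalizing p with
  | nil => exact .refl
  | cons a w ih =>
    have h₁ := Derives.of_isRule (.terminal a) p (letters w)
    have h₂ := ih (p ++ [Symbol.terminal a])
    simp only [List.append_nil, List.append_assoc, List.cons_append, List.nil_append] at h₁ h₂
    exact h₁.trans h₂

theorem Derives.swap (κ : Fin k) (b : BracketSymbol k) (p q : Form k) :
    Derives (p ++ letters [(κ, .D), b] ++ q) (p ++ letters [b, (κ, .D)] ++ q) := by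
  have h₁ := Derives.of_isRule (.swap₁ κ b) p q
  have h₂ := Derives.of_isRule (.swap₂ κ b) p q
  have h₃ := Derives.of_isRule (.swap₃ κ b) p q
  have h₄ := Derives.of_isRule (.swap₄ κ b) p q
  simp only [List.append_nil, List.append_assoc, List.cons_append, List.nil_append, List.map]
    at h₁ h₂ h₃ h₄ ⊢
  exact ((h₁.trans h₂).trans h₃).trans h₄

theorem Derives.move (κ : Fin k) (x : List (BracketSymbol k)) (p q : Form k) :
    Derives (p ++ letters ((κ, .D) :: x) ++ q) (p ++ letters (x ++ [(κ, .D)]) ++ q) := by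
  induction x generalizing p with
  | nil => exact .refl
  | cons b x ih =>
    have h₁ := Derives.swap κ b p (letters x ++ q)
    have h₂ := ih (p ++ [sym (letter b)])
    simp only [List.map, List.append_assoc, List.cons_append, List.nil_append] at h₁ h₂ ⊢
    exact h₁.trans h₂

/-- The level of type κ must fall from at least 1 to 0, so `(κ, .D)` occurs. The first occurrence is
taken: before it the level of κ never drops below 1, so paying for this bracket at the start keeps
it nonnegative. -/
theorem exists_closing (κ : Fin k) (w : List (BracketSymbol k)) (z : Fin k → ℤ)
    (hκ : 1 ≤ z κ) (h : ∀ κ', WeightBalanced (bracketWeight κ') (z κ') w) :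
    ∃ x y, w = x ++ (κ, .D) :: y ∧
      ∀ κ', WeightBalanced (bracketWeight κ') (z κ' + bracketWeight κ' (κ, .D)) (x ++ y) := by
  induction w generalizing z with
  | nil =>
    have := h κ
    simp only [WeightBalanced] at this
    omega
  | cons a w ih =>
    by_cases ha : a = (κ, .D)
    · exact ⟨[], w, by rw [ha, List.nil_append], fun κ' => ha ▸ (h κ').2⟩
    · have hw : 0 ≤ bracketWeight κ a := by
        obtain ⟨κ', _ | _⟩ := a
        · rw [bracketWeight_U]; split_ifs <;> simp
        · rw [bracketWeight_D, if_neg]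
          rintro rfl
          exact ha rfl
      obtain ⟨x, y, rfl, hxy⟩ := ih (fun κ' => z κ' + bracketWeight κ' a)
        (show 1 ≤ z κ + bracketWeight κ a by omega) fun κ' => (h κ').2
      refine ⟨a :: x, y, rfl, fun κ' => ⟨?_, ?_⟩⟩
      · rw [bracketWeight_D]
        split_ifs with h'
        · subst h'; omega
        · simpa using (h κ').1
      · rw [add_right_comm]
        exact hxy κ'

/-- A nonempty string in shuffle Dyck arises from a shorter one by inserting a pair of brackets
and moving the closing one to the right. -/
theorem exists_decomposition {w : List (BracketSymbol k)} (hw : w ∈ shuffleDyck k)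
    (hne : w ≠ []) : ∃ κ x y, w = (κ, .U) :: x ++ (κ, .D) :: y ∧ x ++ y ∈ shuffleDyck k := by
  rw [mem_shuffleDyck_iff_balanced] at hw
  obtain ⟨⟨κ, s⟩, w, rfl⟩ := List.exists_cons_of_ne_nil hne
  obtain rfl : s = .U := by
    rcases s with _ | _
    · rfl
    · simpa using (hw κ).1
  obtain ⟨x, y, rfl, h⟩ := exists_closing κ w _ (by simp) fun κ' => (hw κ').2
  refine ⟨κ, x, y, rfl, (mem_shuffleDyck_iff_balanced _).2 fun κ' => ?_⟩
  have e : 0 + bracketWeight κ' (κ, .U) + bracketWeight κ' (κ, .D) = 0 := by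
    rw [bracketWeight_U, bracketWeight_D]; split_ifs <;> simp
  exact e ▸ h κ'

theorem Derives.closing (κ : Fin k) (x y : List (BracketSymbol k)) (p : Form k) :
    Derives (p ++ [sym (letter (κ, .U)), sym (letter (κ, .D))] ++ letters (x ++ y))
      (p ++ letters ((κ, .U) :: x ++ (κ, .D) :: y)) := by
  have h := Derives.move κ x (p ++ [sym (letter (κ, .U))]) (letters y)
  simpa using h

/-- Induction on the length: derive the shorter word behind `gen`, let `gen` insert the pair in
front of it, and move the closing bracket into place. -/
theorem Derives.gen_letters {w : List (BracketSymbol k)} (hw : w ∈ shuffleDyck k) :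
    Derives [sym gen] (sym gen :: letters w) := by
  by_cases hne : w = []
  · subst hne; exact .refl
  · obtain ⟨κ, x, y, rfl, hxy⟩ := exists_decomposition hw hne
    have h₁ := Derives.gen_letters hxy
    have h₂ := Derives.of_isRule (.pair κ) [] (letters (x ++ y))
    exact (h₁.trans h₂).trans (Derives.closing κ x y [sym gen])
termination_by w.length
decreasing_by subst_vars; simp

theorem Derives.letters_of_mem {w : List (BracketSymbol k)} (hw : w ∈ shuffleDyck k)
    (hne : w ≠ []) : Derives [sym gen] (letters w) := by
  obtain ⟨κ, x, y, rfl, hxy⟩ := exists_decomposition hw hne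
  have h := Derives.of_isRule (.last κ) [] (letters (x ++ y))
  exact ((Derives.gen_letters hxy).trans h).trans (Derives.closing κ x y [])

end ShuffleNT

open ShuffleNT in
theorem language_shuffleGrammar (k : ℕ) : (shuffleGrammar k).language = shuffleDyck k := by
  ext w
  constructor
  · intro h
    have key : ∀ v, Derives [sym start] v →
        (sym start ∈ v → v = [sym start]) ∧ read (sym start) v ∈ shuffleDyck k := by
      intro v hv
      induction hv with
      | refl =>
        exact ⟨fun _ => rfl, (mem_shuffleDyck_iff_balanced _).2 fun _ => rfl⟩
      | tail _ h ih =>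
        exact ⟨fun hv => absurd hv (start_of_produces h ih.1), read_mem_of_produces h ih.1 ih.2⟩
    have hw := (key (w.map Symbol.terminal) h).2
    rwa [read_terminal] at hw
  · intro hw
    change Derives [sym start] (w.map Symbol.terminal)
    by_cases hne : w = []
    · subst hne
      exact Derives.of_isRule .empty [] []
    · exact ((Derives.of_isRule .start [] []).trans (Derives.letters_of_mem hw hne)).trans
        (Derives.terminals w [])

/-! ### Context-free grammars -/

namespace ContextFreeGrammar

variable {T : Type*} (g : ContextFreeGrammar T)

/-- `g.Yields α w`: the terminal string `w` is obtained from `α` by replacing each nonterminal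
by the yield of a parse tree. -/
inductive Yields : List (Symbol T g.NT) → List T → Prop
  | nil : Yields [] []
  | terminal (t : T) {α : List (Symbol T g.NT)} {w : List T} (h : Yields α w) :
      Yields (.terminal t :: α) (t :: w)
  | nonterminal {r : ContextFreeRule T g.NT} (hr : r ∈ g.rules) {α : List (Symbol T g.NT)}
      {x w : List T} (hx : Yields r.output x) (h : Yields α w) :
      Yields (.nonterminal r.input :: α) (x ++ w)

variable {g}

theorem Yields.of_terminals (w : List T) : g.Yields (w.map .terminal) w := by
  induction w with
  | nil => exact .nil
  | cons t w ih => exact .terminal t ih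

theorem Yields.split {α β : List (Symbol T g.NT)} {w : List T} (h : g.Yields (α ++ β) w) :
    ∃ u v, w = u ++ v ∧ g.Yields α u ∧ g.Yields β v := by
  induction α generalizing w with
  | nil => exact ⟨[], w, rfl, .nil, h⟩
  | cons s α ih =>
    rw [List.cons_append] at h
    cases h with
    | terminal t h =>
      obtain ⟨u, v, rfl, hu, hv⟩ := ih h
      exact ⟨t :: u, v, rfl, .terminal t hu, hv⟩
    | nonterminal hr hx h =>
      obtain ⟨u, v, rfl, hu, hv⟩ := ih h
      exact ⟨_, v, (List.append_assoc ..).symm, .nonterminal hr hx hu, hv⟩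

theorem Yields.append {α β : List (Symbol T g.NT)} {u v : List T} (hu : g.Yields α u)
    (hv : g.Yields β v) : g.Yields (α ++ β) (u ++ v) := by
  induction hu with
  | nil => exact hv
  | terminal t _ ih => exact .terminal t ih
  | nonterminal hr hx _ _ ih =>
    rw [List.append_assoc]
    exact .nonterminal hr hx ih

theorem yields_of_derives {α : List (Symbol T g.NT)} {w : List T}
    (h : g.Derives α (w.map .terminal)) : g.Yields α w := by
  induction h using Relation.ReflTransGen.head_induction_on with
  | refl => exact .of_terminals w
  | head h _ ih =>
    obtain ⟨r, hr, h⟩ := h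
    obtain ⟨p, q, rfl, rfl⟩ := h.exists_parts
    obtain ⟨_, v, rfl, hu, hv⟩ := ih.split
    obtain ⟨u, x, rfl, hu, hx⟩ := hu.split
    refine Yields.append (hu.append ?_) hv
    simpa using Yields.nonterminal hr hx .nil

theorem Yields.derives {α : List (Symbol T g.NT)} {w : List T} (h : g.Yields α w) :
    g.Derives α (w.map .terminal) := by
  induction h with
  | nil => exact .refl _
  | terminal t _ ih => exact ih.append_left [.terminal t]
  | @nonterminal r hr α x w _ _ ihx ih =>
    have h1 : g.Produces (.nonterminal r.input :: α) (r.output ++ α) := ⟨r, hr, .head α⟩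
    rw [List.map_append]
    exact h1.trans_derives ((ihx.append_right _).trans (ih.append_left _))

/-- If every rule has at most `m` symbols on its right-hand side, then any parse of a long string
has a subtree whose yield has a length between `l` and `m * l`. -/
theorem Yields.exists_factor {l m : ℕ} (hl : 0 < l) (hm : ∀ r ∈ g.rules, r.output.length ≤ m)
    {α : List (Symbol T g.NT)} {w : List T} (h : g.Yields α w) (hw : α.length * l < w.length) :
    ∃ r ∈ g.rules, ∃ u x v, w = u ++ x ++ v ∧ l < x.length ∧ x.length ≤ m * l ∧
      g.Derives [.nonterminal r.input] (x.map .terminal) ∧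
      g.Derives α (u.map .terminal ++ [.nonterminal r.input] ++ v.map .terminal) := by
  induction h with
  | nil => simp at hw
  | @terminal t α w _ ih =>
    -- Each symbol of the sentential form has a budget of `l` letters; a terminal uses only one, and
    -- `0 < l`.
    simp only [List.length_cons, add_mul] at hw
    obtain ⟨r, hr, u, x, v, rfl, h1, h2, h3, h4⟩ := ih (by omega)
    exact ⟨r, hr, t :: u, x, v, rfl, h1, h2, h3, h4.append_left [.terminal t]⟩
  | @nonterminal r hr α x w hx h ihx ih =>
    have hp : g.Produces [.nonterminal r.input] r.output :=
      ⟨r, hr, ContextFreeRule.Rewrites.input_output⟩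
    -- If the subtree exceeds the budget of its children, descend into it. Otherwise its yield has
    -- length at most `m * l`: it is the desired factor if longer than `l`, and if not, the
    -- remaining symbols still exceed their budget.
    by_cases hxl : r.output.length * l < x.length
    · obtain ⟨r', hr', u, y, v, rfl, h1, h2, h3, h4⟩ := ihx hxl
      refine ⟨r', hr', u, y, v ++ w, by simp, h1, h2, h3, ?_⟩
      have := (((hp.trans_derives h4).append_right α).trans (h.derives.append_left _))
      simpa using this
    · have hxm : x.length ≤ m * l := (not_lt.1 hxl).trans (Nat.mul_le_mul_right l (hm r hr))
      by_cases hx' : l < x.length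
      · refine ⟨r, hr, [], x, w, by simp, hx', hxm, hp.trans_derives hx.derives, ?_⟩
        simpa using h.derives.append_left [.nonterminal r.input]
      · simp only [List.length_cons, List.length_append, add_mul] at hw
        obtain ⟨r', hr', u, y, v, rfl, h1, h2, h3, h4⟩ := ih (by omega)
        refine ⟨r', hr', x ++ u, y, v, by simp, h1, h2, h3, ?_⟩
        have h5 := ((hp.trans_derives hx.derives).append_right α).trans (h4.append_left _)
        simpa using h5

/-- If `f x` is determined by each of the contexts of `x` in the language of `g`, then long
strings in the language have factors `x` whose length lies in a given range, but for which `f x` is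
bounded by a constant that depends on `g` only. -/
theorem exists_bound {f : List T → ℕ}
    (hf : ∀ u x x' v, u ++ x ++ v ∈ g.language → u ++ x' ++ v ∈ g.language → f x = f x') :
    ∃ d : ℕ, ∀ l, 0 < l → ∃ n, ∀ w ∈ g.language, l < w.length →
      ∃ u x v, w = u ++ x ++ v ∧ l < x.length ∧ x.length ≤ n ∧ f x ≤ d := by
  have hA : ∀ A : g.NT, ∃ d : ℕ, ∀ u x v : List T,
      g.Derives [.nonterminal g.initial] (u.map .terminal ++ [.nonterminal A] ++ v.map .terminal) →
      g.Derives [.nonterminal A] (x.map .terminal) → f x ≤ d := by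
    intro A
    -- One derivable word `y` fixes the value of `f` on every word derived from `A` in an admissible
    -- context; an unproductive `A` imposes nothing.
    by_cases h : ∃ x : List T, g.Derives [.nonterminal A] (x.map .terminal)
    · obtain ⟨y, hy⟩ := h
      refine ⟨f y, fun u x v hu hx => (hf u x y v ?_ ?_).le⟩
      all_goals
        rw [mem_language_iff, List.map_append, List.map_append]
        refine hu.trans ((Derives.append_left ?_ _).append_right _)
        assumption
    · exact ⟨0, fun u x v _ hx => (h ⟨x, hx⟩).elim⟩
  choose D hD using hA
  -- The type of nonterminals need not be finite, but only inputs of rules matter. This bound does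
  -- not involve `l`.
  refine ⟨g.rules.sup fun r => D r.input, fun l hl =>
    ⟨(g.rules.sup fun r => r.output.length) * l, fun w hw hlw => ?_⟩⟩
  obtain ⟨r, hr, u, x, v, rfl, h1, h2, h3, h4⟩ := (yields_of_derives hw).exists_factor hl
    (fun r hr => Finset.le_sup (f := fun r => r.output.length) hr) (by simpa using hlw)
  exact ⟨u, x, v, rfl, h1, h2,
    (hD _ u x v h4 h3).trans (Finset.le_sup (f := fun r => D r.input) hr)⟩

end ContextFreeGrammar

/-! ### Shuffle Dyck is not context-free -/

section NotContextFree

variable {k : ℕ} (κ₀ κ₁ : Fin k)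

/-- The string `(₀ⁿ (₁ⁿ )₀ⁿ )₁ⁿ`. -/
def crossing (n : ℕ) : List (BracketSymbol k) :=
  List.replicate n (κ₀, .U) ++ (List.replicate n (κ₁, .U) ++
    (List.replicate n (κ₀, .D) ++ List.replicate n (κ₁, .D)))

variable {κ₀ κ₁}

theorem crossing_mem (n : ℕ) : crossing κ₀ κ₁ n ∈ shuffleDyck k := by
  rw [mem_shuffleDyck_iff_count]
  intro κ
  constructor
  · simp [crossing, List.count_replicate]
  · intro i
    simp [crossing, List.count_replicate, List.take_append, List.take_replicate]
    split_ifs <;> omega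

theorem crossing_getElem? {n i : ℕ} {a : BracketSymbol k}
    (hi : (crossing κ₀ κ₁ n)[i]? = some a) :
    (a = (κ₀, .U) ∧ i < n) ∨ (a = (κ₁, .U) ∧ n ≤ i ∧ i < 2 * n) ∨
    (a = (κ₀, .D) ∧ 2 * n ≤ i ∧ i < 3 * n) ∨ (a = (κ₁, .D) ∧ 3 * n ≤ i) := by
  simp only [crossing, List.getElem?_append, List.getElem?_replicate, List.length_replicate] at hi
  split_ifs at hi <;> simp at hi <;> subst hi
  · left; exact ⟨rfl, by omega⟩
  · right; left; exact ⟨rfl, by omega, by omega⟩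
  · right; right; left; exact ⟨rfl, by omega, by omega⟩
  · right; right; right; exact ⟨rfl, by omega⟩

/-- The sum of the distances from balance in the types `κ₀` and `κ₁`. -/
def imbalance (κ₀ κ₁ : Fin k) (x : List (BracketSymbol k)) : ℕ :=
  (x.map (bracketWeight κ₀)).sum.natAbs + (x.map (bracketWeight κ₁)).sum.natAbs

/-- The total weight of each type is 0, so the context `u`, `v` determines the weight of the middle
factor. -/
theorem imbalance_eq {u x x' v : List (BracketSymbol k)} (h : u ++ x ++ v ∈ shuffleDyck k)
    (h' : u ++ x' ++ v ∈ shuffleDyck k) : imbalance κ₀ κ₁ x = imbalance κ₀ κ₁ x' := by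
  rw [mem_shuffleDyck_iff_balanced] at h h'
  have key : ∀ κ, (x.map (bracketWeight κ)).sum = (x'.map (bracketWeight κ)).sum := by
    intro κ
    have h₁ := ((WeightBalanced.iff_sum le_rfl _).1 (h κ)).1
    have h₂ := ((WeightBalanced.iff_sum le_rfl _).1 (h' κ)).1
    simp only [List.map_append, List.sum_append] at h₁ h₂
    omega
  simp only [imbalance, key]

theorem length_le_count {x : List (BracketSymbol k)}
    (hx : ∀ a ∈ x, a = (κ₀, .U) ∨ a = (κ₁, .U) ∨ a = (κ₀, .D) ∨ a = (κ₁, .D)) :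
    x.length ≤ x.count (κ₀, .U) + x.count (κ₁, .U) + x.count (κ₀, .D) + x.count (κ₁, .D) := by
  induction x with
  | nil => simp
  | cons a x ih =>
    have := ih fun b hb => hx b (List.mem_cons_of_mem _ hb)
    simp only [List.count_cons, List.length_cons]
    rcases hx a List.mem_cons_self with rfl | rfl | rfl | rfl <;>
      simp only [beq_self_eq_true, if_true] <;> omega

/-- A short factor of `crossing κ₀ κ₁ n` has no matching brackets, so it is out of balance by its
full length. -/
theorem length_le_imbalance (hκ : κ₀ ≠ κ₁) {n : ℕ} {u x v : List (BracketSymbol k)}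
    (h : crossing κ₀ κ₁ n = u ++ x ++ v) (hx : x.length ≤ n) : x.length ≤ imbalance κ₀ κ₁ x := by
  have hpos : ∀ a ∈ x, ∃ i < x.length, (a = (κ₀, .U) ∧ u.length + i < n) ∨
      (a = (κ₁, .U) ∧ n ≤ u.length + i ∧ u.length + i < 2 * n) ∨
      (a = (κ₀, .D) ∧ 2 * n ≤ u.length + i ∧ u.length + i < 3 * n) ∨
      (a = (κ₁, .D) ∧ 3 * n ≤ u.length + i) := by
    intro a ha
    obtain ⟨i, hi, rfl⟩ := List.mem_iff_getElem.1 ha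
    refine ⟨i, hi, crossing_getElem? ?_⟩
    rw [h, List.append_assoc, List.getElem?_append_right (by omega), Nat.add_sub_cancel_left,
      List.getElem?_append_left hi, List.getElem?_eq_getElem hi]
  have hc := length_le_count (κ₀ := κ₀) (κ₁ := κ₁) (x := x) fun a ha => by
    obtain ⟨i, -, h⟩ := hpos a ha
    tauto
  -- The opening and closing blocks of one type are separated by a full block of length `n`, too far
  -- apart for a factor of length at most `n` to meet both.
  have h₀ : x.count (κ₀, .U) = 0 ∨ x.count (κ₀, .D) = 0 := by
    by_contra! hne
    obtain ⟨i, hi, hi'⟩ := hpos _ (List.count_pos_iff.1 (Nat.pos_of_ne_zero hne.1))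
    obtain ⟨j, hj, hj'⟩ := hpos _ (List.count_pos_iff.1 (Nat.pos_of_ne_zero hne.2))
    simp [hκ] at hi' hj'
    omega
  have h₁ : x.count (κ₁, .U) = 0 ∨ x.count (κ₁, .D) = 0 := by
    by_contra! hne
    obtain ⟨i, hi, hi'⟩ := hpos _ (List.count_pos_iff.1 (Nat.pos_of_ne_zero hne.1))
    obtain ⟨j, hj, hj'⟩ := hpos _ (List.count_pos_iff.1 (Nat.pos_of_ne_zero hne.2))
    simp [hκ.symm] at hi' hj'
    omega
  simp only [imbalance, sum_bracketWeight]
  omega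

/-- `k`-Shuffle Dyck is not context-free if there are two distinct types of brackets. -/
theorem not_isContextFree_shuffleDyck (h : κ₀ ≠ κ₁) : ¬ (shuffleDyck k).IsContextFree := by
  rintro ⟨g, hg⟩
  obtain ⟨d, hd⟩ := g.exists_bound (f := imbalance κ₀ κ₁) fun u x x' v hx hx' =>
    imbalance_eq (hg ▸ hx) (hg ▸ hx')
  -- The factor will be longer than `d + 1`. Blocks of length `n + d + 1` are at least as long as
  -- the factor and make the whole word long enough, so its imbalance exceeds `d`.
  obtain ⟨n, hn⟩ := hd (d + 1) d.succ_pos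
  obtain ⟨u, x, v, he, h1, h2, h3⟩ := hn (crossing κ₀ κ₁ (n + d + 1))
    (hg ▸ crossing_mem _) (by simp [crossing]; omega)
  have := length_le_imbalance h he (by omega)
  omega

end NotContextFree

theorem mainTheorem2 (k : ℕ) (hk : 2 ≤ k) :
    IsContextSensitive (shuffleDyck k) ∧
    ¬ (shuffleDyck k).IsContextFree ∧
    KtSharp.Formula.language (KtSharp.shuffleDyckFormula k) = shuffleDyck k ∧
    CRASP.Definable (shuffleDyck k) := by
  have hne : (⟨0, by omega⟩ : Fin k) ≠ ⟨1, hk⟩ := by simp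
  exact ⟨⟨shuffleGrammar k, language_shuffleGrammar k⟩, not_isContextFree_shuffleDyck hne,
    KtSharp.language_shuffleDyckFormula k,
    KtSharp.language_shuffleDyckFormula k ▸ CRASP.definable_language _⟩
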